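/- Let $(\gamma_{i,j})_{i,j\ge 1}$ be real numbers with $0\le \gamma_{i,j}=\gamma_{j,i}$ and $\gamma_{i,j}\le A(i+j)$ for all $i,j\ge 1$, where $A>0$ is a constant. Let $\Xi_1$ be the space of real sequences $x=(x_i)_{i\ge 1}$ with $\|x\|_{\Xi_1}:=\sum_{i\ge 1} i|x_i|<\infty$, and let $\Xi_1^+$ be its cone of sequences with non-negative entries. Let $\xi^{in}=(\xi_i^{in})_{i\ge1}\in\Xi_1^+$, and consider the discrete Safronov–Dubovski coagulation equation $$\frac{d\xi_i}{dt}= \xi_{i-1} \sum_{j=1}^{i-1} j \gamma_{i-1,j} \xi_j-\xi_i \sum_{j=1}^{i} j \gamma_{i,j} \xi_j-\sum_{j=i}^{\infty} \gamma_{i,j} \xi_i \xi_j,\qquad \xi_i(0)=\xi_i^{in},\qquad i\ge 1 \tag{1}$$ (the first term is zero for $i=1$). A (weak) solution of (1) on $[0,\infty)$ is a sequence $\xi=(\xi_i)_{i\ge 1}$ of non-negative continuous functions on $[0,\infty)$ such that for each $i\ge 1$ and $t>0$ one has $\sum_{j=i}^\infty\gamma_{i,j}\xi_i\xi_j\in L^1(0,t)$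 and $$\xi_i(t)=\xi_i^{in}+\int_0^t\Big[\xi_{i-1}\sum_{j=1}^{i-1} j \gamma_{i-1,j} \xi_j-\xi_i \sum_{j=1}^{i} j \gamma_{i,j} \xi_j-\sum_{j=i}^{\infty} \gamma_{i,j} \xi_i \xi_j\Big]\,d\tau .$$ Then there is at least one weak solution $\xi$ of (1) on $[0,\infty)$ that conserves mass, that is, $\|\xi(t)\|_{\Xi_1}=\|\xi^{in}\|_{\Xi_1}$ for all $t\ge 0$. Moreover, for every such mass-conserving weak solution $\xi$, each component $\xi_i$, $i\ge 1$, is continuously differentiable on $[0,\infty)$, and $\xi$ is a classical solution of (1): for every $i\ge1$ and $t\ge 0$ the series in (1) converges and the differential equation (1) holds at $t$ (with the one-sided derivative at $t=0$), and $\xi_i(0)=\xi_i^{in}$. -/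

import Mathlib

open Set MeasureTheory

/-! Sequences `(x_i)_{i ≥ 1}` are functions on `ℕ` of which only the entries with index `i ≥ 1`
matter: no definition below depends on an entry with index `0`. Functions of time
`t ∈ [0, ∞)` are functions on `ℝ` of which only the values at `t ≥ 0` matter. -/

namespace SafronovDubovski

/-- Membership in the weighted space `Ξ₁`: `∑_{i ≥ 1} i |x_i| < ∞`
(the term with `i = 0` vanishes). -/
def MemXi (x : ℕ → ℝ) : Prop :=
  Summable fun i : ℕ => (i : ℝ) * |x i|

/-- The norm of `Ξ₁`: `∑_{i ≥ 1} i |x_i|`. -/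
noncomputable def xiNorm (x : ℕ → ℝ) : ℝ :=
  ∑' i : ℕ, (i : ℝ) * |x i|

/-- Membership in the positive cone `Ξ₁⁺`. -/
def MemXiPos (x : ℕ → ℝ) : Prop :=
  MemXi x ∧ ∀ i, 1 ≤ i → 0 ≤ x i

/-- The terms, indexed by `n = j - i ≥ 0`, of the series `∑_{j ≥ i} γ_{i,j} x_i x_j`. -/
def lossTerm (γ : ℕ → ℕ → ℝ) (x : ℕ → ℝ) (i n : ℕ) : ℝ :=
  γ i (i + n) * x i * x (i + n)

/-- The series `∑_{j ≥ i} γ_{i,j} x_i x_j`. -/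
noncomputable def loss (γ : ℕ → ℕ → ℝ) (x : ℕ → ℝ) (i : ℕ) : ℝ :=
  ∑' n : ℕ, lossTerm γ x i n

/-- The right-hand side of the `i`-th equation, `i ≥ 1`:
`x_{i-1} ∑_{j=1}^{i-1} j γ_{i-1,j} x_j - x_i ∑_{j=1}^{i} j γ_{i,j} x_j - ∑_{j ≥ i} γ_{i,j} x_i x_j`.
For `i = 1` the first sum is empty. -/
noncomputable def rhs (γ : ℕ → ℕ → ℝ) (x : ℕ → ℝ) (i : ℕ) : ℝ :=
  x (i - 1) * ∑ j ∈ Finset.Icc 1 (i - 1), (j : ℝ) * γ (i - 1) j * x j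
    - x i * ∑ j ∈ Finset.Icc 1 i, (j : ℝ) * γ i j * x j
    - loss γ x i

/-- `ξ` is a (weak) solution on `[0, ∞)` with initial datum `ξin`: each `ξ_i`, `i ≥ 1`, is
non-negative and continuous on `[0, ∞)`, the loss series converges almost everywhere and is
integrable on `(0, t)` for every `t > 0`, and the equation holds in integrated form. -/
structure IsSolution (γ : ℕ → ℕ → ℝ) (ξin : ℕ → ℝ) (ξ : ℕ → ℝ → ℝ) : Prop where
  nonneg : ∀ i, 1 ≤ i → ∀ t, 0 ≤ t → 0 ≤ ξ i t
  continuousOn : ∀ i, 1 ≤ i → ContinuousOn (ξ i) (Ici 0)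
  summable_loss : ∀ i, 1 ≤ i → ∀ t, 0 < t →
    ∀ᵐ τ ∂(volume.restrict (Ioo 0 t)), Summable (lossTerm γ (fun k => ξ k τ) i)
  integrable_loss : ∀ i, 1 ≤ i → ∀ t, 0 < t →
    IntegrableOn (fun τ => loss γ (fun k => ξ k τ) i) (Ioo 0 t)
  integral_eq : ∀ i, 1 ≤ i → ∀ t, 0 < t →
    ξ i t = ξin i + ∫ τ in (0 : ℝ)..t, rhs γ (fun k => ξ k τ) i

/-- `ξ(t) ∈ Ξ₁` and `‖ξ(t)‖_{Ξ₁} = ‖ξin‖_{Ξ₁}` for all `t ≥ 0`. -/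
def ConservesMass (ξin : ℕ → ℝ) (ξ : ℕ → ℝ → ℝ) : Prop :=
  ∀ t, 0 ≤ t → MemXi (fun i => ξ i t) ∧ xiNorm (fun i => ξ i t) = xiNorm ξin

/-- `ξ` is a classical solution on `[0, ∞)` with initial datum `ξin`: each `ξ_i`, `i ≥ 1`, is
non-negative and continuously differentiable on `[0, ∞)` (one-sided derivative at `0`), the loss
series converges and the differential equation holds at every `t ≥ 0`, and `ξ_i(0) = ξin_i`. -/
structure IsClassicalSolution (γ : ℕ → ℕ → ℝ) (ξin : ℕ → ℝ) (ξ : ℕ → ℝ → ℝ) : Prop where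
  nonneg : ∀ i, 1 ≤ i → ∀ t, 0 ≤ t → 0 ≤ ξ i t
  contDiffOn : ∀ i, 1 ≤ i → ContDiffOn ℝ 1 (ξ i) (Ici 0)
  summable_loss : ∀ i, 1 ≤ i → ∀ t, 0 ≤ t → Summable (lossTerm γ (fun k => ξ k t) i)
  hasDeriv : ∀ i, 1 ≤ i → ∀ t, 0 ≤ t →
    HasDerivWithinAt (ξ i) (rhs γ (fun k => ξ k t) i) (Ici 0) t
  initial : ∀ i, 1 ≤ i → ξ i 0 = ξin i

end SafronovDubovski

namespace SafronovDubovski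

open Filter Topology

/-! ### Generalized dominated convergence for series -/

theorem abs_tsum_sub_sum_range_le {f z : ℕ → ℝ} (hz : Summable z) (hfz : ∀ n, |f n| ≤ z n)
    (m : ℕ) :
    |∑' n, f n - ∑ n ∈ Finset.range m, f n| ≤ ∑' n, z n - ∑ n ∈ Finset.range m, z n := by
  have hf : Summable f := Summable.of_norm_bounded hz hfz
  have h1 := hf.sum_add_tsum_nat_add m
  have h2 := hz.sum_add_tsum_nat_add m
  have h3 : ‖∑' n, f (n + m)‖ ≤ ∑' n, z (n + m) :=
    tsum_of_norm_bounded ((summable_nat_add_iff m).2 hz).hasSum fun n => hfz (n + m)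
  rw [← h1, ← h2, add_sub_cancel_left, add_sub_cancel_left]
  exact h3

/-- Dominated convergence for series with a varying dominating sequence whose sums converge. -/
theorem tendsto_tsum_of_tendsto_dominating {ι : Type*} {l : Filter ι} {f z : ι → ℕ → ℝ}
    {f₀ z₀ : ℕ → ℝ} (hfz : ∀ᶠ a in l, ∀ n, |f a n| ≤ z a n) (hz : ∀ᶠ a in l, Summable (z a))
    (hfz₀ : ∀ n, |f₀ n| ≤ z₀ n) (hz₀ : Summable z₀)
    (hf : ∀ n, Tendsto (fun a => f a n) l (𝓝 (f₀ n)))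
    (hzt : ∀ n, Tendsto (fun a => z a n) l (𝓝 (z₀ n)))
    (hsum : Tendsto (fun a => ∑' n, z a n) l (𝓝 (∑' n, z₀ n))) :
    Tendsto (fun a => ∑' n, f a n) l (𝓝 (∑' n, f₀ n)) := by
  rw [Metric.tendsto_nhds]
  intro ε hε
  obtain ⟨m, hm⟩ : ∃ m, ∑' n, z₀ n - ∑ n ∈ Finset.range m, z₀ n < ε / 3 := by
    have h := (tendsto_const_nhds (x := ∑' n, z₀ n)).sub hz₀.hasSum.tendsto_sum_nat
    rw [sub_self] at h
    exact (h.eventually (gt_mem_nhds (by positivity : (0 : ℝ) < ε / 3))).exists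
  have h1 : ∀ᶠ a in l, ∑' n, z a n - ∑ n ∈ Finset.range m, z a n < ε / 3 :=
    (hsum.sub (tendsto_finsetSum _ fun n _ => hzt n)).eventually (gt_mem_nhds hm)
  have h2 : ∀ᶠ a in l,
      dist (∑ n ∈ Finset.range m, f a n) (∑ n ∈ Finset.range m, f₀ n) < ε / 3 :=
    Metric.tendsto_nhds.1 (tendsto_finsetSum (Finset.range m) fun n _ => hf n) _ (by positivity)
  filter_upwards [h1, h2, hfz, hz] with a h1 h2 h3 h4
  have h5 := abs_tsum_sub_sum_range_le h4 h3 m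
  have h6 := abs_tsum_sub_sum_range_le hz₀ hfz₀ m
  rw [Real.dist_eq] at h2 ⊢
  rw [abs_lt] at h2 ⊢
  rw [abs_le] at h5 h6
  constructor <;> linarith

/-! ### Continuity of the right-hand side -/

/-- The terms of the loss series, indexed by `j` and extended by zero to `j < i`. -/
noncomputable def lossExt (γ : ℕ → ℕ → ℝ) (x : ℕ → ℝ) (i j : ℕ) : ℝ :=
  if i ≤ j then γ i j * x i * x j else 0

theorem lossExt_comp_add (γ : ℕ → ℕ → ℝ) (x : ℕ → ℝ) (i : ℕ) :
    lossExt γ x i ∘ (fun n => i + n) = lossTerm γ x i := by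
  ext n
  simp [lossExt, lossTerm]

theorem lossExt_eq_zero (γ : ℕ → ℕ → ℝ) (x : ℕ → ℝ) (i j : ℕ)
    (hj : j ∉ Set.range fun n => i + n) : lossExt γ x i j = 0 := by
  refine if_neg fun h => hj ⟨j - i, ?_⟩
  simp only
  omega

theorem summable_lossExt_iff (γ : ℕ → ℕ → ℝ) (x : ℕ → ℝ) (i : ℕ) :
    Summable (lossTerm γ x i) ↔ Summable (lossExt γ x i) := by
  rw [← lossExt_comp_add]
  exact (add_right_injective i).summable_iff (lossExt_eq_zero γ x i)

theorem loss_eq_tsum_lossExt (γ : ℕ → ℕ → ℝ) (x : ℕ → ℝ) (i : ℕ) :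
    loss γ x i = ∑' j, lossExt γ x i j := by
  rw [loss, ← lossExt_comp_add]
  refine (add_right_injective i).tsum_eq (f := lossExt γ x i) fun j hj => ?_
  by_contra h
  exact hj (lossExt_eq_zero γ x i j h)

theorem abs_lossExt_le {γ : ℕ → ℕ → ℝ} {C : ℝ} {i : ℕ} (hC : ∀ j, i ≤ j → |γ i j| ≤ C * j)
    (hC0 : 0 ≤ C) (x : ℕ → ℝ) (j : ℕ) : |lossExt γ x i j| ≤ C * |x i| * (j * |x j|) := by
  unfold lossExt
  split_ifs with h
  · rw [abs_mul, abs_mul]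
    calc |γ i j| * |x i| * |x j| ≤ C * j * |x i| * |x j| := by gcongr; exact hC j h
      _ = C * |x i| * (j * |x j|) := by ring
  · rw [abs_zero]
    positivity

theorem summable_lossTerm {γ : ℕ → ℕ → ℝ} {C : ℝ} {i : ℕ} (hC : ∀ j, i ≤ j → |γ i j| ≤ C * j)
    (hC0 : 0 ≤ C) {x : ℕ → ℝ} (hx : MemXi x) : Summable (lossTerm γ x i) := by
  rw [summable_lossExt_iff]
  exact Summable.of_norm_bounded (hx.mul_left _) (abs_lossExt_le hC hC0 x)

theorem abs_loss_le {γ : ℕ → ℕ → ℝ} {C : ℝ} {i : ℕ} (hC : ∀ j, i ≤ j → |γ i j| ≤ C * j)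
    (hC0 : 0 ≤ C) {x : ℕ → ℝ} (hx : MemXi x) : |loss γ x i| ≤ C * |x i| * xiNorm x := by
  rw [loss_eq_tsum_lossExt, xiNorm, ← tsum_mul_left]
  exact tsum_of_norm_bounded (f := lossExt γ x i) (hx.mul_left _).hasSum (abs_lossExt_le hC hC0 x)

/-- If sequences converge componentwise together with their norms in `Ξ₁`, then the loss terms
converge. -/
theorem tendsto_loss {ι : Type*} {l : Filter ι} {γ : ι → ℕ → ℕ → ℝ} {γ₀ : ℕ → ℕ → ℝ}
    {x : ι → ℕ → ℝ} {x₀ : ℕ → ℝ} {C : ℝ} {i : ℕ} (hi : 1 ≤ i) (hC0 : 0 ≤ C)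
    (hC : ∀ a j, i ≤ j → |γ a i j| ≤ C * j) (hC₀ : ∀ j, i ≤ j → |γ₀ i j| ≤ C * j)
    (hγ : ∀ j, Tendsto (fun a => γ a i j) l (𝓝 (γ₀ i j)))
    (hx : ∀ j, 1 ≤ j → Tendsto (fun a => x a j) l (𝓝 (x₀ j)))
    (hmem : ∀ᶠ a in l, MemXi (x a)) (hmem₀ : MemXi x₀)
    (hnorm : Tendsto (fun a => xiNorm (x a)) l (𝓝 (xiNorm x₀))) :
    Tendsto (fun a => loss (γ a) (x a) i) l (𝓝 (loss γ₀ x₀ i)) := by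
  simp only [loss_eq_tsum_lossExt]
  refine tendsto_tsum_of_tendsto_dominating (z := fun a j => C * |x a i| * (j * |x a j|))
    (z₀ := fun j => C * |x₀ i| * (j * |x₀ j|)) (Eventually.of_forall fun a n =>
      abs_lossExt_le (hC a) hC0 _ n) (hmem.mono fun a ha => ha.mul_left _)
    (abs_lossExt_le hC₀ hC0 _) (hmem₀.mul_left _) (fun j => ?_) (fun j => ?_) ?_
  · unfold lossExt
    split_ifs with h
    · exact ((hγ j).mul (hx i hi)).mul (hx j (hi.trans h))
    · exact tendsto_const_nhds
  · rcases Nat.eq_zero_or_pos j with rfl | hj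
    · simp [tendsto_const_nhds]
    · exact ((hx i hi).abs.const_mul C).mul ((hx j hj).abs.const_mul _)
  · simp only [tsum_mul_left]
    exact ((hx i hi).abs.const_mul C).mul hnorm

theorem tendsto_rhs {ι : Type*} {l : Filter ι} {γ : ι → ℕ → ℕ → ℝ} {γ₀ : ℕ → ℕ → ℝ}
    {x : ι → ℕ → ℝ} {x₀ : ℕ → ℝ} {C : ℝ} {i : ℕ} (hi : 1 ≤ i) (hC0 : 0 ≤ C)
    (hC : ∀ a j, i ≤ j → |γ a i j| ≤ C * j) (hC₀ : ∀ j, i ≤ j → |γ₀ i j| ≤ C * j)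
    (hγ : ∀ i j, Tendsto (fun a => γ a i j) l (𝓝 (γ₀ i j)))
    (hx : ∀ j, 1 ≤ j → Tendsto (fun a => x a j) l (𝓝 (x₀ j)))
    (hmem : ∀ᶠ a in l, MemXi (x a)) (hmem₀ : MemXi x₀)
    (hnorm : Tendsto (fun a => xiNorm (x a)) l (𝓝 (xiNorm x₀))) :
    Tendsto (fun a => rhs (γ a) (x a) i) l (𝓝 (rhs γ₀ x₀ i)) := by
  have hflux : ∀ k, 1 ≤ k → Tendsto
      (fun a => x a k * ∑ j ∈ Finset.Icc 1 k, (j : ℝ) * γ a k j * x a j) l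
      (𝓝 (x₀ k * ∑ j ∈ Finset.Icc 1 k, (j : ℝ) * γ₀ k j * x₀ j)) := fun k hk =>
    (hx k hk).mul (tendsto_finsetSum _ fun j hj =>
      ((hγ k j).const_mul _).mul (hx j (Finset.mem_Icc.1 hj).1))
  refine (Tendsto.sub ?_ (hflux i hi)).sub
    (tendsto_loss hi hC0 hC hC₀ (hγ i) hx hmem hmem₀ hnorm)
  rcases Nat.eq_or_lt_of_le hi with rfl | h
  · simp [tendsto_const_nhds]
  · exact hflux (i - 1) (by omega)

/-! ### Kernels -/

/-- Non-negative symmetric kernels of at most linear growth. -/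
structure IsKernel (A : ℝ) (γ : ℕ → ℕ → ℝ) : Prop where
  pos : 0 < A
  nonneg : ∀ i j, 1 ≤ i → 1 ≤ j → 0 ≤ γ i j
  symm : ∀ i j, 1 ≤ i → 1 ≤ j → γ i j = γ j i
  growth : ∀ i j, 1 ≤ i → 1 ≤ j → γ i j ≤ A * ((i : ℝ) + (j : ℝ))

variable {A : ℝ} {γ : ℕ → ℕ → ℝ} {ξin : ℕ → ℝ} {ξ : ℕ → ℝ → ℝ}

theorem IsKernel.le_of_le (h : IsKernel A γ) {i j : ℕ} (hi : 1 ≤ i) (hij : i ≤ j) :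
    γ i j ≤ 2 * A * j := by
  have h1 := h.growth i j hi (hi.trans hij)
  have h2 : (i : ℝ) ≤ j := by exact_mod_cast hij
  nlinarith [h.pos]

theorem IsKernel.abs_le (h : IsKernel A γ) {i : ℕ} (hi : 1 ≤ i) (j : ℕ) (hij : i ≤ j) :
    |γ i j| ≤ 2 * A * j := by
  rw [abs_of_nonneg (h.nonneg i j hi (hi.trans hij))]
  exact h.le_of_le hi hij

/-! ### Mass-conserving solutions are classical -/

theorem ConservesMass.continuousOn_loss (h : IsKernel A γ) (hm : ConservesMass ξin ξ)
    (hc : ∀ i, 1 ≤ i → ContinuousOn (ξ i) (Ici 0)) {i : ℕ} (hi : 1 ≤ i) :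
    ContinuousOn (fun t => loss γ (fun k => ξ k t) i) (Ici 0) := by
  intro t ht
  refine tendsto_loss (γ := fun _ => γ) (x := fun t k => ξ k t) hi (by linarith [h.pos])
    (fun _ => h.abs_le hi) (h.abs_le hi) (fun _ => tendsto_const_nhds) (fun j hj => hc j hj t ht)
    ?_ (hm t ht).1 ?_
  · filter_upwards [self_mem_nhdsWithin] with s hs using (hm s hs).1
  · refine tendsto_const_nhds.congr' ?_
    filter_upwards [self_mem_nhdsWithin] with s hs
    rw [(hm s hs).2, (hm t ht).2]

theorem ConservesMass.continuousOn_rhs (h : IsKernel A γ) (hm : ConservesMass ξin ξ)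
    (hc : ∀ i, 1 ≤ i → ContinuousOn (ξ i) (Ici 0)) {i : ℕ} (hi : 1 ≤ i) :
    ContinuousOn (fun t => rhs γ (fun k => ξ k t) i) (Ici 0) := by
  intro t ht
  refine tendsto_rhs (γ := fun _ => γ) (x := fun t k => ξ k t) hi (by linarith [h.pos])
    (fun _ => h.abs_le hi) (h.abs_le hi) (fun _ _ => tendsto_const_nhds)
    (fun j hj => hc j hj t ht) ?_ (hm t ht).1 ?_
  · filter_upwards [self_mem_nhdsWithin] with s hs using (hm s hs).1
  · refine tendsto_const_nhds.congr' ?_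
    filter_upwards [self_mem_nhdsWithin] with s hs
    rw [(hm s hs).2, (hm t ht).2]

theorem hasDerivWithinAt_of_integral_eq {f g : ℝ → ℝ} {c : ℝ} (hf : ContinuousOn f (Ici 0))
    (hg : ContinuousOn g (Ici 0)) (h : ∀ t, 0 < t → f t = c + ∫ τ in (0 : ℝ)..t, g τ) :
    f 0 = c ∧ ∀ t, 0 ≤ t → HasDerivWithinAt f (g t) (Ici 0) t := by
  have hg' : Continuous fun t => g (max t 0) :=
    hg.comp_continuous (by fun_prop) fun t => le_max_right t 0
  have hint : ∀ t, 0 ≤ t → ∫ τ in (0 : ℝ)..t, g τ = ∫ τ in (0 : ℝ)..t, g (max τ 0) := by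
    intro t ht
    refine intervalIntegral.integral_congr fun τ hτ => ?_
    rw [uIcc_of_le ht] at hτ
    simp only [max_eq_left hτ.1]
  have hd : ∀ t, HasDerivAt (fun t => c + ∫ τ in (0 : ℝ)..t, g (max τ 0)) (g (max t 0)) t :=
    fun t => (hg'.integral_hasStrictDerivAt 0 t).hasDerivAt.const_add c
  have h0 : f 0 = c := by
    have h1 : Tendsto f (𝓝[>] 0) (𝓝 (f 0)) :=
      (hf 0 self_mem_Ici).mono_left (nhdsWithin_mono _ Ioi_subset_Ici_self)
    have h2 : Tendsto f (𝓝[>] 0) (𝓝 (c + ∫ τ in (0 : ℝ)..0, g (max τ 0))) := by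
      refine ((hd 0).continuousAt.tendsto.mono_left nhdsWithin_le_nhds).congr' ?_
      filter_upwards [self_mem_nhdsWithin] with t ht
      rw [h t ht, hint t (le_of_lt ht)]
    simpa using tendsto_nhds_unique h1 h2
  refine ⟨h0, fun t ht => ?_⟩
  have heq : ∀ s ∈ Ici (0 : ℝ), f s = c + ∫ τ in (0 : ℝ)..s, g (max τ 0) := by
    intro s hs
    rcases eq_or_lt_of_le (mem_Ici.1 hs) with rfl | hs'
    · simpa using h0
    · rw [h s hs', hint s hs]
  have := ((hd t).hasDerivWithinAt (s := Ici 0)).congr heq (heq t ht)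
  rwa [max_eq_left ht] at this

theorem contDiffOn_one_of_hasDerivWithinAt {f g : ℝ → ℝ} (hg : ContinuousOn g (Ici 0))
    (h : ∀ t, 0 ≤ t → HasDerivWithinAt f (g t) (Ici 0) t) : ContDiffOn ℝ 1 f (Ici 0) := by
  rw [contDiffOn_one_iff_derivWithin (uniqueDiffOn_Ici 0)]
  refine ⟨fun t ht => (h t ht).differentiableWithinAt, hg.congr fun t ht => ?_⟩
  exact (h t ht).derivWithin (uniqueDiffOn_Ici 0 t ht)

theorem IsSolution.isClassicalSolution (h : IsKernel A γ) (hs : IsSolution γ ξin ξ)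
    (hm : ConservesMass ξin ξ) : IsClassicalSolution γ ξin ξ where
  nonneg := hs.nonneg
  contDiffOn i hi :=
    contDiffOn_one_of_hasDerivWithinAt (hm.continuousOn_rhs h hs.continuousOn hi)
      (hasDerivWithinAt_of_integral_eq (hs.continuousOn i hi)
        (hm.continuousOn_rhs h hs.continuousOn hi) (hs.integral_eq i hi)).2
  summable_loss i hi t ht := summable_lossTerm (h.abs_le hi) (by linarith [h.pos]) (hm t ht).1
  hasDeriv i hi :=
    (hasDerivWithinAt_of_integral_eq (hs.continuousOn i hi)
      (hm.continuousOn_rhs h hs.continuousOn hi) (hs.integral_eq i hi)).2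
  initial i hi :=
    (hasDerivWithinAt_of_integral_eq (hs.continuousOn i hi)
      (hm.continuousOn_rhs h hs.continuousOn hi) (hs.integral_eq i hi)).1

/-- A non-negative mass-conserving family satisfying the differential equations is a weak
solution. -/
theorem ConservesMass.isSolution (h : IsKernel A γ) (hm : ConservesMass ξin ξ)
    (hpos : ∀ i, 1 ≤ i → ∀ t, 0 ≤ t → 0 ≤ ξ i t)
    (hd : ∀ i, 1 ≤ i → ∀ t, 0 ≤ t →
      HasDerivWithinAt (ξ i) (rhs γ (fun k => ξ k t) i) (Ici 0) t)
    (h0 : ∀ i, 1 ≤ i → ξ i 0 = ξin i) : IsSolution γ ξin ξ := by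
  have hc : ∀ i, 1 ≤ i → ContinuousOn (ξ i) (Ici 0) :=
    fun i hi t ht => (hd i hi t ht).continuousWithinAt
  refine ⟨hpos, hc, fun i hi t ht => ?_, fun i hi t ht => ?_, fun i hi t ht => ?_⟩
  · refine (ae_restrict_iff' measurableSet_Ioo).2 (Eventually.of_forall fun τ hτ => ?_)
    exact summable_lossTerm (h.abs_le hi) (by linarith [h.pos]) (hm τ hτ.1.le).1
  · exact (((hm.continuousOn_loss h hc hi).mono Icc_subset_Ici_self).integrableOn_Icc
      (a := 0) (b := t)).mono_set Ioo_subset_Icc_self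
  · have hint : IntervalIntegrable (fun τ => rhs γ (fun k => ξ k τ) i) volume 0 t :=
      ((hm.continuousOn_rhs h hc hi).mono
        (by rw [uIcc_of_le ht.le]; exact Icc_subset_Ici_self)).intervalIntegrable
    rw [intervalIntegral.integral_eq_sub_of_hasDerivAt_of_le ht.le
      ((hc i hi).mono Icc_subset_Ici_self)
      (fun τ hτ => (hd i hi τ hτ.1.le).hasDerivAt (Ici_mem_nhds hτ.1)) hint, h0 i hi]
    ring

/-! ### Finitely supported states -/

/-- Non-negative sequences supported in `{1, …, N}`. -/
structure IsState (N : ℕ) (x : ℕ → ℝ) : Prop where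
  zero : x 0 = 0
  support : ∀ i, N < i → x i = 0
  nonneg : ∀ i, 0 ≤ x i

/-- The rate `x_i ∑_{j ≤ i} j γ_{i,j} x_j` at which particles of size `i` grow to size `i + 1`. -/
noncomputable def flux (γ : ℕ → ℕ → ℝ) (x : ℕ → ℝ) (i : ℕ) : ℝ :=
  x i * ∑ j ∈ Finset.Icc 1 i, (j : ℝ) * γ i j * x j

theorem rhs_eq_flux (γ : ℕ → ℕ → ℝ) (x : ℕ → ℝ) (i : ℕ) :
    rhs γ x i = flux γ x (i - 1) - flux γ x i - loss γ x i := rfl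

section State

variable {N : ℕ} {x : ℕ → ℝ}

theorem IsState.mul_abs_eq_zero (hx : IsState N x) (φ : ℕ → ℝ) (i : ℕ)
    (hi : i ∉ Finset.range (N + 1)) : φ i * |x i| = 0 := by
  rw [hx.support i (by simpa [Nat.lt_succ_iff] using hi)]
  simp

theorem IsState.memXi (hx : IsState N x) : MemXi x :=
  summable_of_ne_finset_zero (s := Finset.range (N + 1)) (hx.mul_abs_eq_zero _)

theorem IsState.xiNorm_eq (hx : IsState N x) :
    xiNorm x = ∑ i ∈ Finset.range (N + 1), (i : ℝ) * x i := by
  rw [xiNorm, tsum_eq_sum (hx.mul_abs_eq_zero _)]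
  exact Finset.sum_congr rfl fun i _ => by rw [abs_of_nonneg (hx.nonneg i)]

theorem sum_mul_abs_le_xiNorm (hx : MemXi x) (s : Finset ℕ) :
    ∑ i ∈ s, (i : ℝ) * |x i| ≤ xiNorm x :=
  hx.sum_le_tsum s fun i _ => by positivity

theorem mul_abs_le_xiNorm (hx : MemXi x) (i : ℕ) : (i : ℝ) * |x i| ≤ xiNorm x := by
  simpa using sum_mul_abs_le_xiNorm hx {i}

theorem xiNorm_nonneg (x : ℕ → ℝ) : 0 ≤ xiNorm x :=
  tsum_nonneg fun i => by positivity

theorem IsState.mul_le_xiNorm (hx : IsState N x) (i : ℕ) : (i : ℝ) * x i ≤ xiNorm x := by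
  simpa [abs_of_nonneg (hx.nonneg i)] using mul_abs_le_xiNorm hx.memXi i

theorem IsState.le_xiNorm (hx : IsState N x) (i : ℕ) : x i ≤ xiNorm x := by
  rcases Nat.eq_zero_or_pos i with rfl | hi
  · rw [hx.zero]
    exact xiNorm_nonneg x
  · have h1 : (1 : ℝ) ≤ i := by exact_mod_cast hi
    nlinarith [hx.mul_le_xiNorm i, hx.nonneg i]

theorem IsState.sum_le (h : IsKernel A γ) (hx : IsState N x) (i : ℕ) :
    ∑ j ∈ Finset.Icc 1 i, (j : ℝ) * γ i j * x j ≤ 2 * A * i * xiNorm x := by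
  have hA := h.pos
  calc ∑ j ∈ Finset.Icc 1 i, (j : ℝ) * γ i j * x j
      ≤ ∑ j ∈ Finset.Icc 1 i, 2 * A * i * ((j : ℝ) * |x j|) := by
        refine Finset.sum_le_sum fun j hj => ?_
        obtain ⟨hj1, hj2⟩ := Finset.mem_Icc.1 hj
        rw [abs_of_nonneg (hx.nonneg j), h.symm i j (hj1.trans hj2) hj1]
        have h1 := mul_le_mul_of_nonneg_right (h.le_of_le hj1 hj2)
          (mul_nonneg (Nat.cast_nonneg (α := ℝ) j) (hx.nonneg j))
        linarith
    _ = 2 * A * i * ∑ j ∈ Finset.Icc 1 i, (j : ℝ) * |x j| := by rw [Finset.mul_sum]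
    _ ≤ 2 * A * i * xiNorm x := by
        gcongr
        exact sum_mul_abs_le_xiNorm hx.memXi _

theorem IsState.sum_nonneg (h : IsKernel A γ) (hx : IsState N x) (i : ℕ) :
    0 ≤ ∑ j ∈ Finset.Icc 1 i, (j : ℝ) * γ i j * x j := by
  refine Finset.sum_nonneg fun j hj => ?_
  obtain ⟨hj1, hj2⟩ := Finset.mem_Icc.1 hj
  exact mul_nonneg (mul_nonneg (Nat.cast_nonneg j) (h.nonneg i j (hj1.trans hj2) hj1)) (hx.nonneg j)

theorem IsState.flux_nonneg (h : IsKernel A γ) (hx : IsState N x) (i : ℕ) : 0 ≤ flux γ x i :=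
  mul_nonneg (hx.nonneg i) (hx.sum_nonneg h i)

theorem IsState.flux_le (h : IsKernel A γ) (hx : IsState N x) (i : ℕ) :
    flux γ x i ≤ 2 * A * xiNorm x * (i * x i) := by
  have := mul_le_mul_of_nonneg_left (hx.sum_le h i) (hx.nonneg i)
  unfold flux
  linarith

theorem IsState.loss_le (h : IsKernel A γ) (hx : IsState N x) {i : ℕ} (hi : 1 ≤ i) :
    |loss γ x i| ≤ 2 * A * x i * xiNorm x := by
  have := abs_loss_le (h.abs_le hi) (by linarith [h.pos]) hx.memXi
  rwa [abs_of_nonneg (hx.nonneg i)] at this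

theorem loss_eq_zero {i : ℕ} (hi : x i = 0) : loss γ x i = 0 := by
  simp [loss, lossTerm, hi]

theorem IsState.rhs_zero (hx : IsState N x) : rhs γ x 0 = 0 := by
  rw [rhs_eq_flux, loss_eq_zero hx.zero]
  simp

theorem IsState.abs_rhs_le (h : IsKernel A γ) (hx : IsState N x) (i : ℕ) :
    |rhs γ x i| ≤ 6 * A * xiNorm x ^ 2 := by
  have hA := h.pos
  have hM := xiNorm_nonneg x
  rcases Nat.eq_zero_or_pos i with rfl | hi
  · rw [hx.rhs_zero, abs_zero]
    positivity
  · have hfl : ∀ k, flux γ x k ≤ 2 * A * xiNorm x ^ 2 := fun k => by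
      have := mul_le_mul_of_nonneg_left (hx.mul_le_xiNorm k)
        (by positivity : (0 : ℝ) ≤ 2 * A * xiNorm x)
      linarith [hx.flux_le h k]
    have hl : |loss γ x i| ≤ 2 * A * xiNorm x ^ 2 := by
      have := mul_le_mul_of_nonneg_left (hx.le_xiNorm i)
        (by positivity : (0 : ℝ) ≤ 2 * A * xiNorm x)
      linarith [hx.loss_le h hi]
    rw [abs_le] at hl
    rw [rhs_eq_flux, abs_le]
    constructor <;>
      linarith [hfl i, hfl (i - 1), hx.flux_nonneg h i, hx.flux_nonneg h (i - 1)]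

theorem IsState.neg_mul_le_rhs (h : IsKernel A γ) (hx : IsState N x) (i : ℕ) :
    -(2 * A * xiNorm x * (N + 1) * x i) ≤ rhs γ x i := by
  have hA := h.pos
  have hM := xiNorm_nonneg x
  rcases Nat.eq_zero_or_pos i with rfl | hi
  · rw [hx.rhs_zero, hx.zero]
    simp
  · have h1 : (i : ℝ) * x i ≤ N * x i := by
      rcases le_or_gt i N with hiN | hiN
      · exact mul_le_mul_of_nonneg_right (by exact_mod_cast hiN) (hx.nonneg i)
      · rw [hx.support i hiN]
        simp
    have h2 := mul_le_mul_of_nonneg_left h1 (by positivity : (0 : ℝ) ≤ 2 * A * xiNorm x)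
    have h3 := (abs_le.1 (hx.loss_le h hi)).2
    rw [rhs_eq_flux]
    linarith [hx.flux_nonneg h (i - 1), hx.flux_le h i]

theorem IsState.loss_eq_sum (hx : IsState N x) (i : ℕ) :
    loss γ x i = ∑ j ∈ Finset.Ico i (N + 1), γ i j * x i * x j := by
  rw [loss_eq_tsum_lossExt, tsum_eq_sum (s := Finset.Ico i (N + 1))]
  · exact Finset.sum_congr rfl fun j hj => if_pos (Finset.mem_Ico.1 hj).1
  · intro j hj
    unfold lossExt
    split_ifs with hij
    · rw [hx.support j (by simp only [Finset.mem_Ico, not_and, not_lt] at hj; have := hj hij; omega),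
        mul_zero]
    · rfl

theorem sum_range_succ_eq_sum_Icc {f : ℕ → ℝ} (hf : f 0 = 0) (i : ℕ) :
    ∑ j ∈ Finset.range (i + 1), f j = ∑ j ∈ Finset.Icc 1 i, f j := by
  symm
  refine Finset.sum_subset (fun j hj => ?_) fun j hj hj' => ?_
  · simp only [Finset.mem_Icc, Finset.mem_range] at hj ⊢
    omega
  · have : j = 0 := by
      simp only [Finset.mem_Icc, Finset.mem_range, not_and, not_le] at hj hj'
      by_contra h0
      have := hj' (by omega)
      omega
    rw [this, hf]

/-- The weak formulation of the truncated equation. -/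
theorem IsState.sum_mul_rhs (h : IsKernel A γ) (hN : ∀ j, γ N j = 0) (hx : IsState N x)
    {φ : ℕ → ℝ} (hφ : φ 0 = 0) :
    ∑ i ∈ Finset.range (N + 1), φ i * rhs γ x i = ∑ i ∈ Finset.range (N + 1),
      ((φ (i + 1) - φ i) * flux γ x i - ∑ j ∈ Finset.Icc 1 i, φ j * (γ i j * x i * x j)) := by
  have hfN : flux γ x N = 0 := by simp [flux, hN]
  have hf0 : flux γ x 0 = 0 := by simp [flux]
  have h1 : ∑ i ∈ Finset.range (N + 1), φ i * flux γ x (i - 1) =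
      ∑ i ∈ Finset.range (N + 1), φ (i + 1) * flux γ x i := by
    rw [Finset.sum_range_succ', Finset.sum_range_succ, hfN, hφ]
    simp
  have h2 : ∑ i ∈ Finset.range (N + 1), φ i * loss γ x i =
      ∑ i ∈ Finset.range (N + 1), ∑ j ∈ Finset.Icc 1 i, φ j * (γ i j * x i * x j) := by
    calc ∑ i ∈ Finset.range (N + 1), φ i * loss γ x i
        = ∑ i ∈ Finset.range (N + 1), ∑ j ∈ Finset.Ico i (N + 1),
            φ i * (γ i j * x i * x j) := by
          simp only [hx.loss_eq_sum, Finset.mul_sum]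
      _ = ∑ j ∈ Finset.range (N + 1), ∑ i ∈ Finset.range (j + 1),
            φ i * (γ i j * x i * x j) := by
          refine Finset.sum_comm' fun i j => ?_
          simp only [Finset.mem_range, Finset.mem_Ico]
          omega
      _ = _ := by
          refine Finset.sum_congr rfl fun i _ => ?_
          rw [sum_range_succ_eq_sum_Icc (by rw [hφ, zero_mul])]
          refine Finset.sum_congr rfl fun j hj => ?_
          obtain ⟨hj1, hj2⟩ := Finset.mem_Icc.1 hj
          rw [h.symm i j (hj1.trans hj2) hj1]
          ring
  simp only [rhs_eq_flux, mul_sub, sub_mul, Finset.sum_sub_distrib, h1, h2]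

theorem IsState.sum_id_mul_rhs (h : IsKernel A γ) (hN : ∀ j, γ N j = 0) (hx : IsState N x) :
    ∑ i ∈ Finset.range (N + 1), (i : ℝ) * rhs γ x i = 0 := by
  rw [hx.sum_mul_rhs h hN (φ := fun i => (i : ℝ)) Nat.cast_zero]
  refine Finset.sum_eq_zero fun i _ => ?_
  rw [flux, Finset.mul_sum, Finset.mul_sum, ← Finset.sum_sub_distrib]
  refine Finset.sum_eq_zero fun j _ => ?_
  push_cast
  ring

theorem IsState.sum_mul_rhs_le (h : IsKernel A γ) (hN : ∀ j, γ N j = 0) (hx : IsState N x)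
    {φ : ℕ → ℝ} (hφ : φ 0 = 0) (hφ0 : ∀ i, 0 ≤ φ i) (hmono : ∀ i, φ i ≤ φ (i + 1))
    (hgrow : ∀ i : ℕ, (i : ℝ) * (φ (i + 1) - φ i) ≤ 3 * φ i) :
    ∑ i ∈ Finset.range (N + 1), φ i * rhs γ x i ≤
      6 * A * xiNorm x * ∑ i ∈ Finset.range (N + 1), φ i * x i := by
  have hA := h.pos
  have hM := xiNorm_nonneg x
  rw [hx.sum_mul_rhs h hN hφ, Finset.mul_sum]
  refine Finset.sum_le_sum fun i _ => ?_
  have h1 : 0 ≤ ∑ j ∈ Finset.Icc 1 i, φ j * (γ i j * x i * x j) :=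
    Finset.sum_nonneg fun j hj => by
      obtain ⟨hj1, hj2⟩ := Finset.mem_Icc.1 hj
      exact mul_nonneg (hφ0 j) (mul_nonneg (mul_nonneg (h.nonneg i j (hj1.trans hj2) hj1)
        (hx.nonneg i)) (hx.nonneg j))
  have h2 := mul_le_mul_of_nonneg_left (hx.flux_le h i) (sub_nonneg.2 (hmono i))
  have h3 := mul_le_mul_of_nonneg_left (hgrow i)
    (mul_nonneg (by positivity : (0 : ℝ) ≤ 2 * A * xiNorm x) (hx.nonneg i))
  linarith

end State

/-! ### The explicit Euler scheme -/

/-- The explicit Euler scheme with step `h`. -/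
noncomputable def euler (γ : ℕ → ℕ → ℝ) (h : ℝ) (x₀ : ℕ → ℝ) : ℕ → ℕ → ℝ
  | 0 => x₀
  | k + 1 => fun i => euler γ h x₀ k i + h * rhs γ (euler γ h x₀ k) i

section Euler

variable {N : ℕ} {x : ℕ → ℝ} {h : ℝ}

theorem euler_succ (γ : ℕ → ℕ → ℝ) (h : ℝ) (x : ℕ → ℝ) (k i : ℕ) :
    euler γ h x (k + 1) i = euler γ h x k i + h * rhs γ (euler γ h x k) i := rfl

theorem IsState.step (hk : IsKernel A γ) (hN : ∀ i j, N ≤ i → γ i j = 0) (hx : IsState N x)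
    (h0 : 0 ≤ h) (h1 : h * (2 * A * xiNorm x * (N + 1)) ≤ 1) :
    IsState N (fun i => x i + h * rhs γ x i) where
  zero := by rw [hx.rhs_zero, hx.zero, mul_zero, add_zero]
  support i hi := by
    have h2 : flux γ x (i - 1) = 0 := by
      simp [flux, hN (i - 1) _ (by omega)]
    have h3 : flux γ x i = 0 := by simp [flux, hx.support i hi]
    rw [rhs_eq_flux, h2, h3, loss_eq_zero (hx.support i hi), hx.support i hi]
    simp
  nonneg i := by
    have h2 := mul_le_mul_of_nonneg_left (hx.neg_mul_le_rhs hk i) h0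
    have h3 := mul_le_mul_of_nonneg_right h1 (hx.nonneg i)
    linarith

theorem IsState.isState_euler (hk : IsKernel A γ) (hN : ∀ i j, N ≤ i → γ i j = 0) (hx : IsState N x)
    (h0 : 0 ≤ h) (h1 : h * (2 * A * xiNorm x * (N + 1)) ≤ 1) (k : ℕ) :
    IsState N (euler γ h x k) ∧ xiNorm (euler γ h x k) = xiNorm x := by
  induction k with
  | zero => exact ⟨hx, rfl⟩
  | succ k ih =>
    obtain ⟨ih1, ih2⟩ := ih
    have hs : IsState N (euler γ h x (k + 1)) :=
      ih1.step hk hN h0 (by rwa [ih2])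
    refine ⟨hs, ?_⟩
    rw [hs.xiNorm_eq]
    simp only [euler_succ, mul_add, Finset.sum_add_distrib]
    rw [← ih1.xiNorm_eq, ih2, add_eq_left]
    simp only [mul_left_comm _ h]
    rw [← Finset.mul_sum, ih1.sum_id_mul_rhs hk fun j => hN N j le_rfl, mul_zero]

theorem IsState.sum_mul_euler_le (hk : IsKernel A γ) (hN : ∀ i j, N ≤ i → γ i j = 0)
    (hx : IsState N x) (h0 : 0 ≤ h) (h1 : h * (2 * A * xiNorm x * (N + 1)) ≤ 1) {φ : ℕ → ℝ}
    (hφ : φ 0 = 0) (hφ0 : ∀ i, 0 ≤ φ i) (hmono : ∀ i, φ i ≤ φ (i + 1))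
    (hgrow : ∀ i : ℕ, (i : ℝ) * (φ (i + 1) - φ i) ≤ 3 * φ i) (k : ℕ) :
    ∑ i ∈ Finset.range (N + 1), φ i * euler γ h x k i ≤
      Real.exp (6 * A * xiNorm x * (k * h)) * ∑ i ∈ Finset.range (N + 1), φ i * x i := by
  induction k with
  | zero => simp [euler]
  | succ k ih =>
    have hA := hk.pos
    have hM := xiNorm_nonneg x
    obtain ⟨hs, hM'⟩ := hx.isState_euler hk hN h0 h1 k
    have h2 := mul_le_mul_of_nonneg_left
      (hs.sum_mul_rhs_le hk (fun j => hN N j le_rfl) hφ hφ0 hmono hgrow) h0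
    rw [hM'] at h2
    set S := ∑ i ∈ Finset.range (N + 1), φ i * euler γ h x k i with hS
    have hS0 : 0 ≤ S := Finset.sum_nonneg fun i _ => mul_nonneg (hφ0 i) (hs.nonneg i)
    calc ∑ i ∈ Finset.range (N + 1), φ i * euler γ h x (k + 1) i
        = S + h * ∑ i ∈ Finset.range (N + 1),
            φ i * rhs γ (euler γ h x k) i := by
          simp only [euler_succ, mul_add, Finset.sum_add_distrib, mul_left_comm _ h,
            ← Finset.mul_sum, hS]
      _ ≤ (6 * A * xiNorm x * h + 1) * S := by linarith
      _ ≤ Real.exp (6 * A * xiNorm x * h) * (Real.exp (6 * A * xiNorm x * (k * h)) *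
            ∑ i ∈ Finset.range (N + 1), φ i * x i) := by
          refine mul_le_mul (Real.add_one_le_exp _) ih hS0 (Real.exp_nonneg _)
      _ = _ := by
          rw [← mul_assoc, ← Real.exp_add]
          congr 2
          push_cast
          ring

/-- If the right-hand side is close to `c` along a stretch of the scheme, the increment of the
scheme is close to `c` times the elapsed time. -/
theorem abs_euler_sub_le (h0 : 0 ≤ h) {i n m : ℕ} (hnm : n ≤ m) {c ε : ℝ}
    (hc : ∀ k, n ≤ k → k < m → |rhs γ (euler γ h x k) i - c| ≤ ε) :
    |euler γ h x m i - euler γ h x n i - (m * h - n * h) * c| ≤ (m * h - n * h) * ε := by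
  induction m, hnm using Nat.le_induction with
  | base => simp
  | succ m hnm ih =>
    have h1 := ih fun k hk hk' => hc k hk (by omega)
    have h2 := mul_le_mul_of_nonneg_left (hc m hnm (by omega)) h0
    rw [← abs_of_nonneg h0, ← abs_mul, abs_of_nonneg h0] at h2
    rw [euler_succ]
    rw [abs_le] at h1 h2 ⊢
    push_cast
    constructor <;> linarith

end Euler

/-! ### Truncated moments -/

/-- The weight `i min (1, i / m)`. -/
noncomputable def weight (m i : ℕ) : ℝ := i * min 1 ((i : ℝ) / m)

theorem weight_zero (m : ℕ) : weight m 0 = 0 := by simp [weight]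

theorem weight_nonneg (m i : ℕ) : 0 ≤ weight m i := by unfold weight; positivity

theorem weight_le (m i : ℕ) : weight m i ≤ i :=
  mul_le_of_le_one_right (Nat.cast_nonneg i) (min_le_left _ _)

theorem weight_eq {m i : ℕ} (hm : 1 ≤ m) (hi : m ≤ i) : weight m i = i := by
  have h1 : (0 : ℝ) < m := by exact_mod_cast hm
  have h2 : (m : ℝ) ≤ i := by exact_mod_cast hi
  rw [weight, min_eq_left ((one_le_div h1).2 h2), mul_one]

theorem weight_mono (m i : ℕ) : weight m i ≤ weight m (i + 1) := by
  unfold weight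
  gcongr <;> simp

theorem mul_weight_succ_sub_le (m i : ℕ) :
    (i : ℝ) * (weight m (i + 1) - weight m i) ≤ 3 * weight m i := by
  rcases Nat.eq_zero_or_pos i with rfl | hi
  · simp [weight]
  have h1 : (1 : ℝ) ≤ i := by exact_mod_cast hi
  have h2 : (i : ℝ) * min 1 (((i + 1 : ℕ) : ℝ) / m) ≤ (i + 1) * min 1 ((i : ℝ) / m) := by
    rw [mul_min_of_nonneg _ _ (by positivity), mul_min_of_nonneg _ _ (by positivity)]
    refine min_le_min (by linarith) (le_of_eq ?_)
    push_cast
    ring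
  have h3 : 0 ≤ min 1 ((i : ℝ) / m) := by positivity
  have h4 : 0 ≤ min 1 (((i + 1 : ℕ) : ℝ) / m) := by positivity
  unfold weight
  push_cast at *
  nlinarith

theorem tendsto_tsum_weight {y : ℕ → ℝ} (hy : MemXi y) :
    Tendsto (fun m => ∑' i, weight m i * |y i|) atTop (𝓝 0) := by
  have h := tendsto_tsum_of_dominated_convergence (𝓕 := atTop)
    (f := fun m i => weight m i * |y i|) (g := fun _ => 0) hy (fun i => ?_)
    (Eventually.of_forall fun m i => ?_)
  · simpa using h
  · have h1 : Tendsto (fun m : ℕ => (i : ℝ) * ((i : ℝ) / m) * |y i|) atTop (𝓝 0) := by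
      simpa using ((tendsto_const_div_atTop_nhds_zero_nat (i : ℝ)).const_mul (i : ℝ)).mul_const |y i|
    refine squeeze_zero (fun m => mul_nonneg (weight_nonneg m i) (abs_nonneg _)) (fun m => ?_) h1
    unfold weight
    gcongr
    exact min_le_right _ _
  · rw [Real.norm_of_nonneg (mul_nonneg (weight_nonneg m i) (abs_nonneg _))]
    exact mul_le_mul_of_nonneg_right (weight_le m i) (abs_nonneg _)

/-! ### Truncation -/

/-- The kernel `γ` restricted to sizes below `N`. -/
noncomputable def truncKernel (γ : ℕ → ℕ → ℝ) (N i j : ℕ) : ℝ :=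
  if i < N ∧ j < N then γ i j else 0

/-- The entries of a sequence with index in `{1, …, N}`. -/
noncomputable def truncSeq (x : ℕ → ℝ) (N i : ℕ) : ℝ :=
  if 1 ≤ i ∧ i ≤ N then x i else 0

theorem IsKernel.trunc (h : IsKernel A γ) (N : ℕ) : IsKernel A (truncKernel γ N) where
  pos := h.pos
  nonneg i j hi hj := by
    unfold truncKernel
    split_ifs
    exacts [h.nonneg i j hi hj, le_rfl]
  symm i j hi hj := by
    unfold truncKernel
    simp only [h.symm i j hi hj, and_comm]
  growth i j hi hj := by
    unfold truncKernel
    split_ifs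
    · exact h.growth i j hi hj
    · have := h.pos
      positivity

theorem truncKernel_eq_zero (γ : ℕ → ℕ → ℝ) {N i : ℕ} (j : ℕ) (hi : N ≤ i) :
    truncKernel γ N i j = 0 :=
  if_neg fun h => by omega

theorem tendsto_truncKernel (γ : ℕ → ℕ → ℝ) (i j : ℕ) :
    Tendsto (fun N => truncKernel γ N i j) atTop (𝓝 (γ i j)) := by
  refine tendsto_const_nhds.congr' ?_
  filter_upwards [eventually_gt_atTop i, eventually_gt_atTop j] with N h1 h2
  exact (if_pos ⟨h1, h2⟩).symm

theorem isState_truncSeq (hξ : MemXiPos ξin) (N : ℕ) : IsState N (truncSeq ξin N) where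
  zero := if_neg (by omega)
  support i hi := if_neg (by omega)
  nonneg i := by
    unfold truncSeq
    split_ifs with hi
    exacts [hξ.2 i hi.1, le_rfl]

theorem tendsto_truncSeq (x : ℕ → ℝ) {i : ℕ} (hi : 1 ≤ i) :
    Tendsto (fun N => truncSeq x N i) atTop (𝓝 (x i)) := by
  refine tendsto_const_nhds.congr' ?_
  filter_upwards [eventually_ge_atTop i] with N h1
  exact (if_pos ⟨hi, h1⟩).symm

theorem sum_mul_truncSeq (φ x : ℕ → ℝ) (hφ : φ 0 = 0) (N : ℕ) :
    ∑ i ∈ Finset.range (N + 1), φ i * truncSeq x N i = ∑ i ∈ Finset.range (N + 1), φ i * x i := by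
  refine Finset.sum_congr rfl fun i hi => ?_
  rcases Nat.eq_zero_or_pos i with rfl | h
  · simp [hφ]
  · rw [truncSeq, if_pos ⟨h, by simpa [Nat.lt_succ_iff] using hi⟩]

theorem MemXiPos.mul_abs_eq (hξ : MemXiPos ξin) {φ : ℕ → ℝ} (hφ : φ 0 = 0) (i : ℕ) :
    φ i * |ξin i| = φ i * ξin i := by
  rcases Nat.eq_zero_or_pos i with rfl | h
  · simp [hφ]
  · rw [abs_of_nonneg (hξ.2 i h)]

theorem xiNorm_truncSeq (hξ : MemXiPos ξin) (N : ℕ) :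
    xiNorm (truncSeq ξin N) = ∑ i ∈ Finset.range (N + 1), (i : ℝ) * |ξin i| := by
  rw [(isState_truncSeq hξ N).xiNorm_eq,
    sum_mul_truncSeq (fun i => (i : ℝ)) ξin Nat.cast_zero]
  exact Finset.sum_congr rfl fun i _ =>
    (hξ.mul_abs_eq (φ := fun i => (i : ℝ)) Nat.cast_zero i).symm

theorem xiNorm_truncSeq_le (hξ : MemXiPos ξin) (N : ℕ) :
    xiNorm (truncSeq ξin N) ≤ xiNorm ξin := by
  rw [xiNorm_truncSeq hξ]
  exact sum_mul_abs_le_xiNorm hξ.1 _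

theorem tendsto_xiNorm_truncSeq (hξ : MemXiPos ξin) :
    Tendsto (fun N => xiNorm (truncSeq ξin N)) atTop (𝓝 (xiNorm ξin)) := by
  simp only [xiNorm_truncSeq hξ]
  exact hξ.1.hasSum.tendsto_sum_nat.comp (tendsto_add_atTop_nat 1)

/-! ### Approximate solutions -/

/-- The time step of the `N`-th approximation. -/
noncomputable def stepSize (A : ℝ) (ξin : ℕ → ℝ) (N : ℕ) : ℝ :=
  1 / ((2 * A * xiNorm ξin + 1) * (N + 1))

theorem stepSize_pos (hA : 0 < A) (ξin : ℕ → ℝ) (N : ℕ) : 0 < stepSize A ξin N := by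
  have := xiNorm_nonneg ξin
  unfold stepSize
  positivity

theorem stepSize_mul_le (hA : 0 < A) (hξ : MemXiPos ξin) (N : ℕ) :
    stepSize A ξin N * (2 * A * xiNorm (truncSeq ξin N) * (N + 1)) ≤ 1 := by
  have h1 := xiNorm_nonneg ξin
  have h2 := xiNorm_truncSeq_le hξ N
  rw [stepSize, one_div, inv_mul_le_one₀ (by positivity)]
  gcongr
  nlinarith

theorem tendsto_stepSize (A : ℝ) (ξin : ℕ → ℝ) :
    Tendsto (stepSize A ξin) atTop (𝓝 0) := by
  have h := (tendsto_one_div_add_atTop_nhds_zero_nat (𝕜 := ℝ)).const_mul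
    (1 / (2 * A * xiNorm ξin + 1))
  rw [mul_zero] at h
  refine h.congr fun N => ?_
  rw [stepSize, one_div_mul_one_div]

/-- The `N`-th approximate solution: the Euler scheme for the truncated data, constant in time
on each step. -/
noncomputable def approx (A : ℝ) (γ : ℕ → ℕ → ℝ) (ξin : ℕ → ℝ) (N : ℕ) (t : ℝ) : ℕ → ℝ :=
  euler (truncKernel γ N) (stepSize A ξin N) (truncSeq ξin N) ⌊t / stepSize A ξin N⌋₊

theorem approx_zero (A : ℝ) (γ : ℕ → ℕ → ℝ) (ξin : ℕ → ℝ) (N : ℕ) :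
    approx A γ ξin N 0 = truncSeq ξin N := by
  simp [approx, euler]

theorem isState_approx (h : IsKernel A γ) (hξ : MemXiPos ξin) (N : ℕ) (t : ℝ) :
    IsState N (approx A γ ξin N t) ∧
      xiNorm (approx A γ ξin N t) = xiNorm (truncSeq ξin N) :=
  (isState_truncSeq hξ N).isState_euler (h.trunc N) (fun _ j hi => truncKernel_eq_zero γ j hi)
    (stepSize_pos h.pos ξin N).le (stepSize_mul_le h.pos hξ N) _

theorem approx_mem_Icc (h : IsKernel A γ) (hξ : MemXiPos ξin) (N : ℕ) (t : ℝ) (i : ℕ) :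
    approx A γ ξin N t i ∈ Icc 0 (xiNorm ξin) := by
  obtain ⟨h1, h2⟩ := isState_approx h hξ N t
  exact ⟨h1.nonneg i, (h1.le_xiNorm i).trans (h2.le.trans (xiNorm_truncSeq_le hξ N))⟩

theorem abs_approx_sub_le (hA : 0 < A) (γ : ℕ → ℕ → ℝ) (ξin : ℕ → ℝ) (N i : ℕ) {a b c ε : ℝ}
    (ha : 0 ≤ a) (hab : a ≤ b) (hε : 0 ≤ ε)
    (hc : ∀ t ∈ Icc a b, |rhs (truncKernel γ N) (approx A γ ξin N t) i - c| ≤ ε) :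
    |approx A γ ξin N b i - approx A γ ξin N a i - (b - a) * c| ≤
      (b - a + stepSize A ξin N) * ε + stepSize A ξin N * |c| := by
  have hh := stepSize_pos hA ξin N
  unfold approx at hc ⊢
  set h := stepSize A ξin N
  have hn := Nat.floor_le (div_nonneg ha hh.le)
  have hm := Nat.floor_le (div_nonneg (ha.trans hab) hh.le)
  have hn' := Nat.lt_floor_add_one (a / h)
  have hm' := Nat.lt_floor_add_one (b / h)
  have hnm : ⌊a / h⌋₊ ≤ ⌊b / h⌋₊ := Nat.floor_le_floor (by gcongr)
  rw [le_div_iff₀ hh] at hn hm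
  rw [div_lt_iff₀ hh] at hn' hm'
  have key := abs_euler_sub_le (γ := truncKernel γ N) (x := truncSeq ξin N) hh.le (i := i) hnm
    (c := c) (ε := ε) fun k hk hk' => by
      have hkb : (k : ℝ) * h ≤ b := by
        have : (k : ℝ) ≤ ⌊b / h⌋₊ := by exact_mod_cast hk'.le
        nlinarith
      have hka : a < (k + 1) * h := by
        have : (⌊a / h⌋₊ : ℝ) ≤ k := by exact_mod_cast hk
        nlinarith
      have hfl : ⌊max a (k * h) / h⌋₊ = k := by
        rw [Nat.floor_eq_iff (by positivity), le_div_iff₀ hh, div_lt_iff₀ hh]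
        exact ⟨le_max_right _ _, max_lt hka (by linarith)⟩
      have := hc (max a (k * h)) ⟨le_max_left _ _, max_le hab hkb⟩
      rwa [hfl] at this
  set n := ⌊a / h⌋₊
  set m := ⌊b / h⌋₊
  have h1 : |((m : ℝ) * h - n * h) - (b - a)| ≤ h := by
    rw [abs_le]
    constructor <;> linarith
  have h2 : |((m : ℝ) * h - n * h - (b - a)) * c| ≤ h * |c| := by
    rw [abs_mul]
    gcongr
  have h3 : ((m : ℝ) * h - n * h) * ε ≤ (b - a + h) * ε := by
    gcongr
    linarith [(abs_le.1 h1).2]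
  rw [abs_le] at key h2 ⊢
  constructor <;> linarith

theorem abs_approx_sub_le_mul (h : IsKernel A γ) (hξ : MemXiPos ξin) (N i : ℕ) {s t : ℝ}
    (hs : 0 ≤ s) (ht : 0 ≤ t) :
    |approx A γ ξin N t i - approx A γ ξin N s i| ≤
      (|t - s| + stepSize A ξin N) * (6 * A * xiNorm ξin ^ 2) := by
  have hA := h.pos
  have hB : ∀ τ, |rhs (truncKernel γ N) (approx A γ ξin N τ) i - 0| ≤ 6 * A * xiNorm ξin ^ 2 := by
    intro τ
    obtain ⟨h1, h2⟩ := isState_approx h hξ N τ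
    have h3 := xiNorm_nonneg (approx A γ ξin N τ)
    rw [sub_zero]
    refine (h1.abs_rhs_le (h.trunc N) i).trans ?_
    gcongr
    exact h2.le.trans (xiNorm_truncSeq_le hξ N)
  rcases le_total s t with hst | hst
  · have := abs_approx_sub_le hA γ ξin N i hs hst (by positivity) fun τ _ => hB τ
    rw [abs_of_nonneg (sub_nonneg.2 hst)]
    simpa using this
  · have := abs_approx_sub_le hA γ ξin N i ht hst (by positivity) fun τ _ => hB τ
    rw [abs_sub_comm t s, abs_of_nonneg (sub_nonneg.2 hst), abs_sub_comm]
    simpa using this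

theorem approx_tail_le (h : IsKernel A γ) (hξ : MemXiPos ξin) (N : ℕ) {m : ℕ} (hm : 1 ≤ m) {t : ℝ}
    (ht : 0 ≤ t) :
    xiNorm (approx A γ ξin N t) - ∑ i ∈ Finset.range m, (i : ℝ) * approx A γ ξin N t i ≤
      Real.exp (6 * A * xiNorm ξin * t) * ∑' i, weight m i * |ξin i| := by
  have hA := h.pos
  have hh := stepSize_pos hA ξin N
  have hs := (isState_approx h hξ N t).1
  have h0 := xiNorm_truncSeq_le hξ N
  have h1 := (isState_truncSeq hξ N).sum_mul_euler_le (h.trunc N)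
    (fun _ j hi => truncKernel_eq_zero γ j hi) hh.le (stepSize_mul_le hA hξ N)
    (weight_zero m) (weight_nonneg m) (weight_mono m) (mul_weight_succ_sub_le m)
    ⌊t / stepSize A ξin N⌋₊
  have h2 : (⌊t / stepSize A ξin N⌋₊ : ℝ) * stepSize A ξin N ≤ t :=
    (le_div_iff₀ hh).1 (Nat.floor_le (div_nonneg ht hh.le))
  have h3 : ∑ i ∈ Finset.range (N + 1), weight m i * truncSeq ξin N i ≤
      ∑' i, weight m i * |ξin i| := by
    rw [sum_mul_truncSeq _ _ (weight_zero m)]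
    simp only [← hξ.mul_abs_eq (weight_zero m)]
    refine Summable.sum_le_tsum _ (fun i _ => mul_nonneg (weight_nonneg m i) (abs_nonneg _)) ?_
    exact Summable.of_nonneg_of_le (fun i => mul_nonneg (weight_nonneg m i) (abs_nonneg _))
      (fun i => mul_le_mul_of_nonneg_right (weight_le m i) (abs_nonneg _)) hξ.1
  have h4 : xiNorm (approx A γ ξin N t) - ∑ i ∈ Finset.range m, (i : ℝ) * approx A γ ξin N t i ≤
      ∑ i ∈ Finset.range (N + 1), weight m i * approx A γ ξin N t i := by
    rw [hs.xiNorm_eq, sub_le_iff_le_add,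
      ← Finset.sum_filter_add_sum_filter_not (Finset.range (N + 1)) (fun i => m ≤ i)]
    refine add_le_add ?_ ?_
    · refine (Finset.sum_le_sum fun i hi => ?_).trans (Finset.sum_le_sum_of_subset_of_nonneg
        (Finset.filter_subset _ _) fun i _ _ => mul_nonneg (weight_nonneg m i) (hs.nonneg i))
      rw [weight_eq hm (Finset.mem_filter.1 hi).2]
    · refine Finset.sum_le_sum_of_subset_of_nonneg (fun i hi => ?_)
        fun i _ _ => mul_nonneg (Nat.cast_nonneg i) (hs.nonneg i)
      simpa using (Finset.mem_filter.1 hi).2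
  refine h4.trans (h1.trans (mul_le_mul ?_ h3 ?_ (Real.exp_nonneg _)))
  · refine Real.exp_le_exp.2 ?_
    have := xiNorm_nonneg ξin
    gcongr
  · exact Finset.sum_nonneg fun i _ =>
      mul_nonneg (weight_nonneg m i) ((isState_truncSeq hξ N).nonneg i)

/-! ### Passage to the limit -/

theorem exists_limit_approx (h : IsKernel A γ) (hξ : MemXiPos ξin) :
    ∃ ξ : ℕ → ℝ → ℝ, ∀ i t, 0 ≤ ξ i t ∧
      Tendsto (fun N => approx A γ ξin N t i) (hyperfilter ℕ) (𝓝 (ξ i t)) := by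
  have key : ∀ i t, ∃ y, 0 ≤ y ∧
      Tendsto (fun N => approx A γ ξin N t i) (hyperfilter ℕ) (𝓝 y) := by
    intro i t
    obtain ⟨y, hy, hy'⟩ := isCompact_iff_ultrafilter_le_nhds.1
      (isCompact_Icc (a := (0 : ℝ)) (b := xiNorm ξin))
      ((hyperfilter ℕ).map fun N => approx A γ ξin N t i)
      (by
        rw [le_principal_iff]
        exact Filter.mem_map.2 (univ_mem' fun N => approx_mem_Icc h hξ N t i))
    exact ⟨y, hy.1, hy'⟩
  choose ξ h1 h2 using key
  exact ⟨ξ, fun i t => ⟨h1 i t, h2 i t⟩⟩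

theorem conservesMass_of_tendsto (h : IsKernel A γ) (hξ : MemXiPos ξin)
    (hpos : ∀ i t, 0 ≤ ξ i t) (hlim : ∀ i t,
      Tendsto (fun N => approx A γ ξin N t i) (hyperfilter ℕ) (𝓝 (ξ i t))) :
    ConservesMass ξin ξ := by
  intro t ht
  have hM := (tendsto_xiNorm_truncSeq hξ).mono_left Nat.hyperfilter_le_atTop
  have hsum : ∀ m, Tendsto (fun N => xiNorm (truncSeq ξin N) -
      ∑ i ∈ Finset.range m, (i : ℝ) * approx A γ ξin N t i) (hyperfilter ℕ)
      (𝓝 (xiNorm ξin - ∑ i ∈ Finset.range m, (i : ℝ) * ξ i t)) := fun m =>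
    hM.sub (tendsto_finsetSum _ fun i _ => (hlim i t).const_mul _)
  have hlow : ∀ m, 0 ≤ xiNorm ξin - ∑ i ∈ Finset.range m, (i : ℝ) * ξ i t := fun m => by
    refine ge_of_tendsto' (hsum m) fun N => sub_nonneg.2 ?_
    obtain ⟨h1, h2⟩ := isState_approx h hξ N t
    rw [← h2]
    refine le_of_eq_of_le ?_ (sum_mul_abs_le_xiNorm h1.memXi (Finset.range m))
    exact Finset.sum_congr rfl fun i _ => by rw [abs_of_nonneg (h1.nonneg i)]
  have hup : ∀ m, 1 ≤ m → xiNorm ξin - ∑ i ∈ Finset.range m, (i : ℝ) * ξ i t ≤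
      Real.exp (6 * A * xiNorm ξin * t) * ∑' i, weight m i * |ξin i| := fun m hm => by
    refine le_of_tendsto' (hsum m) fun N => ?_
    rw [← (isState_approx h hξ N t).2]
    exact approx_tail_le h hξ N hm ht
  have h0 : Tendsto (fun m => xiNorm ξin - ∑ i ∈ Finset.range m, (i : ℝ) * ξ i t) atTop (𝓝 0) := by
    have h1 := (tendsto_tsum_weight hξ.1).const_mul (Real.exp (6 * A * xiNorm ξin * t))
    rw [mul_zero] at h1
    refine tendsto_of_tendsto_of_tendsto_of_le_of_le' tendsto_const_nhds h1
      (Eventually.of_forall hlow) ?_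
    filter_upwards [eventually_ge_atTop 1] with m hm using hup m hm
  have h1 : HasSum (fun i : ℕ => (i : ℝ) * |ξ i t|) (xiNorm ξin) := by
    rw [hasSum_iff_tendsto_nat_of_nonneg fun i => by positivity]
    simp only [abs_of_nonneg (hpos _ t)]
    simpa using (tendsto_const_nhds (x := xiNorm ξin)).sub h0
  exact ⟨h1.summable, h1.tsum_eq⟩

theorem tendsto_approx_prod (h : IsKernel A γ) (hξ : MemXiPos ξin)
    (hlim : ∀ i t, Tendsto (fun N => approx A γ ξin N t i) (hyperfilter ℕ) (𝓝 (ξ i t)))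
    (i : ℕ) {s : ℝ} (hs : 0 ≤ s) :
    Tendsto (fun p : ℕ × ℝ => approx A γ ξin p.1 p.2 i)
      ((hyperfilter ℕ : Filter ℕ) ×ˢ 𝓝[Ici 0] s) (𝓝 (ξ i s)) := by
  have h1 : Tendsto (fun p : ℕ × ℝ => approx A γ ξin p.1 s i)
      ((hyperfilter ℕ : Filter ℕ) ×ˢ 𝓝[Ici 0] s) (𝓝 (ξ i s)) := (hlim i s).comp tendsto_fst
  have h2 : Tendsto (fun p : ℕ × ℝ => |p.2 - s|)
      ((hyperfilter ℕ : Filter ℕ) ×ˢ 𝓝[Ici 0] s) (𝓝 0) := by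
    have : Tendsto (fun t : ℝ => |t - s|) (𝓝[Ici 0] s) (𝓝 0) := by
      have hc : Continuous fun t : ℝ => |t - s| := by fun_prop
      simpa using (hc.tendsto s).mono_left nhdsWithin_le_nhds
    exact this.comp tendsto_snd
  have h3 : Tendsto (fun p : ℕ × ℝ => stepSize A ξin p.1)
      ((hyperfilter ℕ : Filter ℕ) ×ˢ 𝓝[Ici 0] s) (𝓝 0) :=
    ((tendsto_stepSize A ξin).mono_left Nat.hyperfilter_le_atTop).comp tendsto_fst
  have h4 := (h2.add h3).mul_const (6 * A * xiNorm ξin ^ 2)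
  rw [add_zero, zero_mul] at h4
  have h5 : Tendsto (fun p : ℕ × ℝ => approx A γ ξin p.1 p.2 i - approx A γ ξin p.1 s i)
      ((hyperfilter ℕ : Filter ℕ) ×ˢ 𝓝[Ici 0] s) (𝓝 0) := by
    refine squeeze_zero_norm' ?_ h4
    have : ∀ᶠ p : ℕ × ℝ in (hyperfilter ℕ : Filter ℕ) ×ˢ 𝓝[Ici 0] s, p.2 ∈ Ici (0 : ℝ) :=
      tendsto_snd.eventually self_mem_nhdsWithin
    filter_upwards [this] with p hp
    exact abs_approx_sub_le_mul h hξ p.1 i hs hp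
  simpa using h1.add h5

theorem tendsto_rhs_approx_prod (h : IsKernel A γ) (hξ : MemXiPos ξin)
    (hlim : ∀ i t, Tendsto (fun N => approx A γ ξin N t i) (hyperfilter ℕ) (𝓝 (ξ i t)))
    (hm : ConservesMass ξin ξ) {i : ℕ} (hi : 1 ≤ i) {s : ℝ} (hs : 0 ≤ s) :
    Tendsto (fun p : ℕ × ℝ => rhs (truncKernel γ p.1) (approx A γ ξin p.1 p.2) i)
      ((hyperfilter ℕ : Filter ℕ) ×ˢ 𝓝[Ici 0] s) (𝓝 (rhs γ (fun k => ξ k s) i)) := by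
  refine tendsto_rhs (γ := fun p : ℕ × ℝ => truncKernel γ p.1) hi (by linarith [h.pos])
    (fun p => (h.trunc p.1).abs_le hi) (h.abs_le hi) (fun i j =>
      ((tendsto_truncKernel γ i j).mono_left Nat.hyperfilter_le_atTop).comp tendsto_fst)
    (fun j _ => tendsto_approx_prod h hξ hlim j hs)
    (Eventually.of_forall fun p => (isState_approx h hξ p.1 p.2).1.memXi) (hm s hs).1 ?_
  rw [(hm s hs).2]
  simp only [(isState_approx h hξ _ _).2]
  exact ((tendsto_xiNorm_truncSeq hξ).mono_left Nat.hyperfilter_le_atTop).comp tendsto_fst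

theorem hasDerivWithinAt_of_tendsto (h : IsKernel A γ) (hξ : MemXiPos ξin)
    (hlim : ∀ i t, Tendsto (fun N => approx A γ ξin N t i) (hyperfilter ℕ) (𝓝 (ξ i t)))
    (hm : ConservesMass ξin ξ) {i : ℕ} (hi : 1 ≤ i) {s : ℝ} (hs : 0 ≤ s) :
    HasDerivWithinAt (ξ i) (rhs γ (fun k => ξ k s) i) (Ici 0) s := by
  set c := rhs γ (fun k => ξ k s) i with hc
  rw [hasDerivWithinAt_iff_isLittleO, Asymptotics.isLittleO_iff]
  intro ε hε
  have h1 := (tendsto_rhs_approx_prod h hξ hlim hm hi hs).eventually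
    (Metric.closedBall_mem_nhds _ hε)
  obtain ⟨P, hP, Q, hQ, hPQ⟩ := eventually_prod_iff.1 h1
  obtain ⟨δ, hδ, hball⟩ := Metric.mem_nhdsWithin_iff.1 hQ
  have key : ∀ a b, 0 ≤ a → a ≤ b → |a - s| < δ → |b - s| < δ →
      |ξ i b - ξ i a - (b - a) * c| ≤ (b - a) * ε := by
    intro a b ha hab has hbs
    have hstep := (tendsto_stepSize A ξin).mono_left Nat.hyperfilter_le_atTop
    have hR : Tendsto (fun N => (b - a + stepSize A ξin N) * ε + stepSize A ξin N * |c|)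
        (hyperfilter ℕ) (𝓝 ((b - a) * ε)) := by
      simpa using ((hstep.const_add (b - a)).mul_const ε).add (hstep.mul_const |c|)
    refine le_of_tendsto_of_tendsto
      (((hlim i b).sub (hlim i a)).sub tendsto_const_nhds).abs hR ?_
    filter_upwards [hP] with N hN
    refine abs_approx_sub_le h.pos γ ξin N i ha hab hε.le fun t ht => ?_
    refine hPQ hN (hball ⟨?_, ha.trans ht.1⟩)
    rw [Metric.mem_ball, Real.dist_eq, abs_lt]
    rw [abs_lt] at has hbs
    constructor <;> linarith [ht.1, ht.2]
  filter_upwards [inter_mem_nhdsWithin (Ici 0) (Metric.ball_mem_nhds s hδ)] with t ht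
  obtain ⟨ht0, hts⟩ := ht
  rw [Metric.mem_ball, Real.dist_eq] at hts
  rw [Real.norm_eq_abs, Real.norm_eq_abs, smul_eq_mul]
  rcases le_total s t with hst | hst
  · have := key s t hs hst (by simpa using hδ) hts
    rwa [abs_of_nonneg (sub_nonneg.2 hst), mul_comm ε]
  · have := key t s ht0 hst hts (by simpa using hδ)
    rw [abs_sub_comm t s, abs_of_nonneg (sub_nonneg.2 hst), mul_comm ε, ← abs_neg]
    refine le_of_eq_of_le (congrArg _ ?_) this
    ring

theorem exists_massConserving_solution (h : IsKernel A γ) (hξ : MemXiPos ξin) :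
    ∃ ξ : ℕ → ℝ → ℝ, IsSolution γ ξin ξ ∧ ConservesMass ξin ξ := by
  obtain ⟨ξ, hlim⟩ := exists_limit_approx h hξ
  have hm := conservesMass_of_tendsto h hξ (fun i t => (hlim i t).1) fun i t => (hlim i t).2
  refine ⟨ξ, hm.isSolution h (fun i _ t _ => (hlim i t).1) (fun i hi t ht =>
    hasDerivWithinAt_of_tendsto h hξ (fun i t => (hlim i t).2) hm hi ht) fun i hi => ?_, hm⟩
  refine tendsto_nhds_unique (hlim i 0).2 ?_
  simp only [approx_zero]
  exact (tendsto_truncSeq ξin hi).mono_left Nat.hyperfilter_le_atTop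

end SafronovDubovski

theorem mainTheorem3 (γ : ℕ → ℕ → ℝ) (A : ℝ) (hA : 0 < A)
    (hγ_nonneg : ∀ i j, 1 ≤ i → 1 ≤ j → 0 ≤ γ i j)
    (hγ_symm : ∀ i j, 1 ≤ i → 1 ≤ j → γ i j = γ j i)
    (hγ_growth : ∀ i j, 1 ≤ i → 1 ≤ j → γ i j ≤ A * ((i : ℝ) + (j : ℝ)))
    (ξin : ℕ → ℝ) (hξin : SafronovDubovski.MemXiPos ξin) :
    (∃ ξ : ℕ → ℝ → ℝ, SafronovDubovski.IsSolution γ ξin ξ ∧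
      SafronovDubovski.ConservesMass ξin ξ) ∧
    (∀ ξ : ℕ → ℝ → ℝ, SafronovDubovski.IsSolution γ ξin ξ →
      SafronovDubovski.ConservesMass ξin ξ →
      (∀ i, 1 ≤ i → ContDiffOn ℝ 1 (ξ i) (Set.Ici 0)) ∧
      SafronovDubovski.IsClassicalSolution γ ξin ξ) := by
  have h : SafronovDubovski.IsKernel A γ := ⟨hA, hγ_nonneg, hγ_symm, hγ_growth⟩
  refine ⟨SafronovDubovski.exists_massConserving_solution h hξin, fun ξ hs hm => ?_⟩
  have hcl := hs.isClassicalSolution h hm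
  exact ⟨hcl.contDiffOn, hcl⟩
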